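/- Let $X$ be a real Hausdorff locally convex space with topological dual $X^*$. For $A \subseteq X$, $x \in A$ and $\varepsilon \ge 0$, let $$N^{\varepsilon}_A(x) := \partial_\varepsilon \delta_A(x) = \{x^* \in X^* : \langle x^*, y - x\rangle \le \varepsilon \text{ for all } y \in A\}$$ be the $\varepsilon$-normal set of $A$ at $x$, i.e. the $\varepsilon$-subdifferential at $x$ of the indicator function $\delta_A$ (equal to $0$ on $A$ and to $+\infty$ off $A$). Let $\{C_t : t \in T\}$ be a nonempty family (with $T$ an arbitrary nonempty index set) of closed convex subsets of $X$ and let $C := \bigcap_{t\in T} C_t$. Then for every $\varepsilon \ge 0$ and every $x \in C$, $$N^{\varepsilon}_C(x) = \bigcap_{\gamma > 0} \operatorname{cl} \bigcup \Big\{ \sum_{t \in A} N^{\eta_t}_{C_t}(x) \; : \; A \subseteq T \text{ finite},\ \eta_t \ge 0 \ (t \in A),\ \sum_{t\in A} \eta_t = \varepsilon + \gamma \Big\},$$ where the sums are Minkowski sums. The closure $\operatorname{cl}$ may be taken in the weak-$*$ topology $w(X^*,X)$, and equally in any other locally convex topology on $X^*$ compatible with the duality, i.e. one whose continuous linear functionals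 are exactly the evaluations $x^* \mapsto \langle x^*, x\rangle$, $x \in X$ (for instance the Mackey topology $\tau(X^*,X)$). -/

import Mathlib

open scoped Topology Pointwise

noncomputable section

/-- The indicator function of a set: `0` on the set and `+∞` off it. -/
def indicatorFun {X : Type*} (A : Set X) (x : X) : EReal :=
  open Classical in if x ∈ A then 0 else ⊤

section Dual

variable {X : Type*} [AddCommGroup X] [Module ℝ X] [TopologicalSpace X]

/-- The `ε`-subdifferential of `f : X → [-∞, ∞]` at `x`, a subset of the topological dual of `X`;
it is empty when `f x` is not finite. -/
def epsSubdifferential (ε : ℝ) (f : X → EReal) (x : X) : Set (WeakDual ℝ X) :=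
  {φ | f x ≠ ⊥ ∧ f x ≠ ⊤ ∧ ∀ y : X, ((φ (y - x) : ℝ) : EReal) ≤ f y - f x + (ε : EReal)}

/-- The `ε`-normal set of `A` at `x`: the `ε`-subdifferential of the indicator function. -/
def epsNormalSet (ε : ℝ) (A : Set X) (x : X) : Set (WeakDual ℝ X) :=
  epsSubdifferential ε (indicatorFun A) x

/-- The union of all Minkowski sums `∑ t ∈ A, N^{η t}_{C t}(x)` over finite sets `A` of indices and
nonnegative `η t`, `t ∈ A`, with `∑ t ∈ A, η t = r`. -/
def finiteNormalSums {T : Type*} (C : T → Set X) (x : X) (r : ℝ) : Set (WeakDual ℝ X) :=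
  {φ | ∃ (A : Finset T) (η : T → ℝ), (∀ t ∈ A, 0 ≤ η t) ∧ ∑ t ∈ A, η t = r ∧
    φ ∈ ∑ t ∈ A, epsNormalSet (η t) (C t) x}

/-- A topology `σ` on the dual `X*` is compatible with the duality `(X*, X)`: it is a locally convex
vector space topology whose continuous linear functionals are exactly the evaluations at points
of `X`. (It is automatically Hausdorff.) The weak-* and the Mackey topology are examples. -/
structure IsCompatibleTopology (σ : TopologicalSpace (WeakDual ℝ X)) : Prop where
  addGroup : @IsTopologicalAddGroup (WeakDual ℝ X) σ _
  smul : @ContinuousSMul ℝ (WeakDual ℝ X) _ _ σ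
  locallyConvex : @LocallyConvexSpace ℝ (WeakDual ℝ X) _ _ _ _ σ
  dual : ∀ Φ : WeakDual ℝ X →ₗ[ℝ] ℝ, Continuous[σ, inferInstance] Φ ↔
    ∃ x : X, ∀ φ : WeakDual ℝ X, Φ φ = φ x

end Dual

end

section EpsNormal

variable {X : Type*} [AddCommGroup X] [Module ℝ X] [TopologicalSpace X]

/-! A Hahn–Banach argument. The union of sums at level `ε + γ` is convex and contains every
`N^{ε+γ}_{C t}(x)`. If `φ` lies outside its closure, compatibility makes the separating functional a
point `z : X`, with `ψ z < α < φ z` for all `ψ` in the union. By a bipolar argument in each `C t`,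
the point `x + ((ε + γ) / α) • z` lies in every `C t`, and there `φ` exceeds its value at `x` by
more than `ε + γ`, so `φ` is not `ε`-normal. Conversely, adding the inequalities bounds each sum by
`ε + γ` on the intersection; this bound passes to the closure, and `γ → 0`. -/

theorem mem_epsNormalSet_iff {ε : ℝ} {A : Set X} {x : X} (hx : x ∈ A) {φ : WeakDual ℝ X} :
    φ ∈ epsNormalSet ε A x ↔ ∀ y ∈ A, φ (y - x) ≤ ε := by
  simp only [epsNormalSet, epsSubdifferential, indicatorFun, Set.mem_ofPred_eq, if_pos hx]
  constructor
  · rintro ⟨-, -, h⟩ y hy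
    simpa [hy, -map_sub, ← EReal.coe_le_coe_iff] using h y
  · refine fun h ↦ ⟨by simp, by simp, fun y ↦ ?_⟩
    by_cases hy : y ∈ A
    · simpa [hy, -map_sub, ← EReal.coe_le_coe_iff] using h y hy
    · simp [hy]

/-- Extending `η` and `g` by zero off `A` lets two decompositions be combined over the union of
their index sets. -/
theorem mem_finiteNormalSums_iff {T : Type*} {C : T → Set X} {x : X} (hx : ∀ t, x ∈ C t) {r : ℝ}
    {φ : WeakDual ℝ X} :
    φ ∈ finiteNormalSums C x r ↔ ∃ (A : Finset T) (η : T → ℝ) (g : T → WeakDual ℝ X),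
      (∀ t, 0 ≤ η t ∧ (∀ y ∈ C t, g t (y - x) ≤ η t) ∧ (t ∉ A → η t = 0 ∧ g t = 0)) ∧
      ∑ t ∈ A, η t = r ∧ ∑ t ∈ A, g t = φ := by
  classical
  simp only [finiteNormalSums, Set.mem_ofPred_eq, Set.mem_finsetSum]
  constructor
  · rintro ⟨A, η, hη, hr, g, hg, hφ⟩
    refine ⟨A, fun t ↦ if t ∈ A then η t else 0, fun t ↦ if t ∈ A then g t else 0,
      fun t ↦ ?_, ?_, ?_⟩
    · by_cases ht : t ∈ A
      · simpa [ht, -map_sub] using ⟨hη t ht, (mem_epsNormalSet_iff (hx t)).1 (hg ht)⟩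
      · simp only [ht, if_false, not_false_eq_true, le_refl, true_and, and_true, forall_const]
        exact fun y _ ↦ le_rfl
    · rw [← hr]
      exact Finset.sum_congr rfl fun t ht ↦ if_pos ht
    · rw [← hφ]
      exact Finset.sum_congr rfl fun t ht ↦ if_pos ht
  · rintro ⟨A, η, g, h, hr, hφ⟩
    exact ⟨A, η, fun t _ ↦ (h t).1, hr, g,
      fun {t} _ ↦ (mem_epsNormalSet_iff (hx t)).2 (h t).2.1, hφ⟩

theorem convex_finiteNormalSums {T : Type*} {C : T → Set X} {x : X} (hx : ∀ t, x ∈ C t) (r : ℝ) :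
    Convex ℝ (finiteNormalSums C x r) := by
  classical
  intro φ hφ ψ hψ a b ha hb hab
  rw [mem_finiteNormalSums_iff hx] at hφ hψ ⊢
  obtain ⟨A, η, g, h, hr, rfl⟩ := hφ
  obtain ⟨B, θ, k, h', hr', rfl⟩ := hψ
  refine ⟨A ∪ B, fun t ↦ a * η t + b * θ t, fun t ↦ a • g t + b • k t, fun t ↦ ⟨?_, ?_, ?_⟩,
    ?_, ?_⟩
  · have := (h t).1
    have := (h' t).1
    positivity
  · intro y hy
    change a * g t (y - x) + b * k t (y - x) ≤ _
    exact add_le_add (mul_le_mul_of_nonneg_left ((h t).2.1 y hy) ha)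
      (mul_le_mul_of_nonneg_left ((h' t).2.1 y hy) hb)
  · intro ht
    rw [Finset.mem_union, not_or] at ht
    have hA := (h t).2.2 ht.1
    have hB := (h' t).2.2 ht.2
    simp [hA, hB]
  · rw [Finset.sum_add_distrib, ← Finset.mul_sum, ← Finset.mul_sum,
      ← Finset.sum_subset Finset.subset_union_left fun t _ ht ↦ ((h t).2.2 ht).1,
      ← Finset.sum_subset Finset.subset_union_right fun t _ ht ↦ ((h' t).2.2 ht).1, hr, hr',
      ← add_mul, hab, one_mul]
  · rw [Finset.sum_add_distrib, ← Finset.smul_sum, ← Finset.smul_sum,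
      ← Finset.sum_subset Finset.subset_union_left fun t _ ht ↦ ((h t).2.2 ht).2,
      ← Finset.sum_subset Finset.subset_union_right fun t _ ht ↦ ((h' t).2.2 ht).2]

theorem epsNormalSet_subset_finiteNormalSums {T : Type*} (C : T → Set X) (x : X) {r : ℝ}
    (hr : 0 ≤ r) (t : T) : epsNormalSet r (C t) x ⊆ finiteNormalSums C x r :=
  fun φ hφ ↦ ⟨{t}, fun _ ↦ r, fun _ _ ↦ hr, by simp, by simpa using hφ⟩

theorem apply_sub_le_of_mem_finiteNormalSums {T : Type*} {C : T → Set X} {x y : X}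
    (hx : ∀ t, x ∈ C t) (hy : ∀ t, y ∈ C t) {r : ℝ} {φ : WeakDual ℝ X}
    (hφ : φ ∈ finiteNormalSums C x r) : φ (y - x) ≤ r := by
  obtain ⟨A, η, g, h, rfl, rfl⟩ := (mem_finiteNormalSums_iff hx).1 hφ
  have : (∑ t ∈ A, g t) (y - x) = ∑ t ∈ A, g t (y - x) :=
    map_sum ((topDualPairing ℝ X).flip (y - x)) g A
  rw [this]
  exact Finset.sum_le_sum fun t _ ↦ (h t).2.1 y (hy t)

/-- A point on which every element of the `r`-normal set is at most `α` becomes, after scaling by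
`r / α`, a displacement from `x` that stays in the set: a form of the bipolar theorem. -/
theorem add_smul_mem_of_forall_epsNormalSet_le [IsTopologicalAddGroup X] [ContinuousSMul ℝ X]
    [LocallyConvexSpace ℝ X] {D : Set X} (hclosed : IsClosed D) (hconvex : Convex ℝ D) {x z : X}
    (hx : x ∈ D) {r α : ℝ} (hr : 0 < r) (hα : 0 < α)
    (h : ∀ ψ ∈ epsNormalSet r D x, ψ z ≤ α) : x + (r / α) • z ∈ D := by
  by_contra hz
  obtain ⟨f, u, hu, huz⟩ := geometric_hahn_banach_closed_point hconvex hclosed hz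
  have hc : 0 < u - f x := sub_pos.2 (hu x hx)
  rw [map_add, map_smul, smul_eq_mul] at huz
  -- The factor rescales the gap `u - f x` to exactly `r`.
  have hmem : StrongDual.toWeakDual ((r / (u - f x)) • f) ∈ epsNormalSet r D x := by
    rw [mem_epsNormalSet_iff hx]
    intro y hy
    change r / (u - f x) * f (y - x) ≤ r
    rw [map_sub, div_mul_eq_mul_div, div_le_iff₀ hc]
    exact mul_le_mul_of_nonneg_left (by linarith [hu y hy]) hr.le
  have hle : r / (u - f x) * f z ≤ α := h _ hmem
  rw [div_mul_eq_mul_div, div_le_iff₀ hc] at hle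
  have hlt : u - f x < r / α * f z := by linarith
  rw [div_mul_eq_mul_div, lt_div_iff₀ hα] at hlt
  linarith

/-- A bare linear map with separate continuity is the form that `IsCompatibleTopology.dual` accepts.
-/
theorem exists_dual_separation {E : Type*} [AddCommGroup E] [Module ℝ E] [TopologicalSpace E]
    [IsTopologicalAddGroup E] [ContinuousSMul ℝ E] [LocallyConvexSpace ℝ E] {s : Set E}
    (hs : Convex ℝ s) {a : E} (ha : a ∉ closure s) :
    ∃ (f : E →ₗ[ℝ] ℝ) (u : ℝ), Continuous f ∧ (∀ b ∈ s, f b < u) ∧ u < f a := by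
  obtain ⟨f, u, h, hu⟩ := geometric_hahn_banach_closed_point hs.closure isClosed_closure ha
  exact ⟨f.toLinearMap, u, f.continuous, fun b hb ↦ h b (subset_closure hb), hu⟩

theorem IsCompatibleTopology.epsNormalSet_iInter_eq [IsTopologicalAddGroup X] [ContinuousSMul ℝ X]
    [LocallyConvexSpace ℝ X] {σ : TopologicalSpace (WeakDual ℝ X)} (hσ : IsCompatibleTopology σ)
    {T : Type*} [Nonempty T] {C : T → Set X} (hclosed : ∀ t, IsClosed (C t))
    (hconvex : ∀ t, Convex ℝ (C t)) {ε : ℝ} (hε : 0 ≤ ε) {x : X} (hx : x ∈ ⋂ t, C t) :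
    epsNormalSet ε (⋂ t, C t) x =
      ⋂ γ : ℝ, ⋂ _ : 0 < γ, closure[σ] (finiteNormalSums C x (ε + γ)) := by
  have hx' : ∀ t, x ∈ C t := Set.mem_iInter.1 hx
  ext φ
  rw [mem_epsNormalSet_iff hx]
  simp only [Set.mem_iInter]
  constructor
  · intro h γ hγ
    by_contra hφ
    obtain ⟨Φ, α, hΦ, hα, hαφ⟩ := @exists_dual_separation (WeakDual ℝ X) _ _ σ hσ.addGroup hσ.smul
      hσ.locallyConvex _ (convex_finiteNormalSums hx' (ε + γ)) _ hφ
    obtain ⟨z, hz⟩ := (hσ.dual Φ).1 hΦ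
    simp only [hz] at hα hαφ
    have hr : 0 < ε + γ := by linarith
    have hN (t : T) (ψ) (hψ : ψ ∈ epsNormalSet (ε + γ) (C t) x) : ψ z < α :=
      hα ψ (epsNormalSet_subset_finiteNormalSums C x hr.le t hψ)
    -- The zero functional is normal to any `C t`; this needs an index.
    have hα0 : 0 < α := by
      obtain ⟨t⟩ := ‹Nonempty T›
      exact hN t 0 ((mem_epsNormalSet_iff (hx' t)).2 fun y _ ↦ hr.le)
    have hmem : ∀ t, x + ((ε + γ) / α) • z ∈ C t := fun t ↦
      add_smul_mem_of_forall_epsNormalSet_le (hclosed t) (hconvex t) (hx' t) hr hα0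
        fun ψ hψ ↦ (hN t ψ hψ).le
    have hle := h _ hmem
    rw [add_sub_cancel_left, map_smul, smul_eq_mul, div_mul_eq_mul_div, div_le_iff₀ hα0] at hle
    -- Contradiction: `(ε + γ) * α < (ε + γ) * φ z ≤ ε * α`.
    nlinarith [mul_lt_mul_of_pos_left hαφ hr, mul_pos hγ hα0]
  · intro h y hy
    refine le_of_forall_pos_le_add fun γ hγ ↦ ?_
    have hcont : Continuous[σ, inferInstance] ((topDualPairing ℝ X).flip (y - x)) :=
      (hσ.dual ((topDualPairing ℝ X).flip (y - x))).2 ⟨y - x, fun _ ↦ rfl⟩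
    have hcl : IsClosed[σ] {ψ : WeakDual ℝ X | ψ (y - x) ≤ ε + γ} :=
      @IsClosed.preimage _ _ σ _ _ hcont _ isClosed_Iic
    exact @closure_minimal (WeakDual ℝ X) σ (finiteNormalSums C x (ε + γ))
      {ψ | ψ (y - x) ≤ ε + γ} (fun ψ hψ ↦ apply_sub_le_of_mem_finiteNormalSums hx' hy hψ) hcl φ
      (h γ hγ)

theorem isCompatibleTopology_weakDual :
    IsCompatibleTopology (inferInstance : TopologicalSpace (WeakDual ℝ X)) where
  addGroup := inferInstanceAs (IsTopologicalAddGroup (WeakBilin (topDualPairing ℝ X)))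
  smul := inferInstance
  locallyConvex := inferInstanceAs (LocallyConvexSpace ℝ (WeakBilin (topDualPairing ℝ X)))
  dual Φ := by
    constructor
    · intro hΦ
      obtain ⟨x, hx⟩ := LinearMap.dualEmbedding_surjective (topDualPairing ℝ X) ⟨Φ, hΦ⟩
      exact ⟨x, fun φ ↦ (DFunLike.congr_fun hx φ).symm⟩
    · rintro ⟨x, hx⟩
      exact (WeakDual.eval_continuous x).congr fun φ ↦ (hx φ).symm

end EpsNormal

theorem mainTheorem8 {X : Type*} [AddCommGroup X] [Module ℝ X] [TopologicalSpace X]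
    [IsTopologicalAddGroup X] [ContinuousSMul ℝ X] [LocallyConvexSpace ℝ X] [T2Space X]
    {T : Type*} [Nonempty T] (C : T → Set X)
    (hclosed : ∀ t, IsClosed (C t)) (hconvex : ∀ t, Convex ℝ (C t))
    (ε : ℝ) (hε : 0 ≤ ε) (x : X) (hx : x ∈ ⋂ t, C t) :
    (epsNormalSet ε (⋂ t, C t) x =
      ⋂ γ : ℝ, ⋂ _ : 0 < γ, closure (finiteNormalSums C x (ε + γ))) ∧
    (∀ σ : TopologicalSpace (WeakDual ℝ X), IsCompatibleTopology σ →
      epsNormalSet ε (⋂ t, C t) x =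
        ⋂ γ : ℝ, ⋂ _ : 0 < γ, closure[σ] (finiteNormalSums C x (ε + γ))) :=
  ⟨isCompatibleTopology_weakDual.epsNormalSet_iInter_eq hclosed hconvex hε hx,
    fun _ hσ ↦ hσ.epsNormalSet_iInter_eq hclosed hconvex hε hx⟩
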